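/- Let $R$ be a commutative ring containing $\mathbb{Q}$ (for example $\mathbb{R}$ or $\mathbb{C}$), and let $(m_n)_{n\ge 1}$ be a formal moment sequence, i.e. an arbitrary sequence in $R$, with the convention $m_0=1$. Consider the formal power series $$F(z)=\sum_{n\ge 0}\frac{m_n}{n!}z^n,\qquad M(z)=\sum_{n\ge 0}m_n z^n .$$ The classical cumulants $\kappa_n$, the free cumulants $c_n$ and the boolean cumulants $h_n$ ($n\ge 1$) of $(m_n)$ are defined by $$\sum_{n\ge 1}\frac{\kappa_n}{n!}z^n=\log F(z),\qquad M(z)=C(zM(z))\ \text{ with }\ C(z)=1+\sum_{n\ge 1}c_nz^n,\qquad M(z)=\frac{1}{1-H(z)}\ \text{ with }\ H(z)=\sum_{n\ge 1}h_nz^n .$$ For a partition $\pi$ of $[n]=\{1,\dots,n\}$ and a sequence $(f_k)_{k\ge 1}$ put $f_\pi=\prod_{B\in\pi}f_{|B|}$, the product over the blocks of $\pi$. Two distinct blocks $B_1,B_2$ of $\pi$ cross if there are $a,c$ in one of them and $b,d$ in the other one with $a<b<c<d$; the connected components of $\pi$ are the unions of the classes of blocks under the equivalence relation generated by crossing. The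 partition $\pi$ is - connected if no nonempty proper subinterval of $[n]$ is a union of blocks of $\pi$; - irreducible if $1$ and $n$ lie in the same connected component of $\pi$; - noncrossing if no two distinct blocks of $\pi$ cross. Let $\Pi_n^{\mathrm{conn}}$, $\Pi_n^{\mathrm{irr}}$ and $NC_n^{\mathrm{irr}}$ be the sets of connected, of irreducible, and of irreducible noncrossing partitions of $[n]$. Theorem. For every $n\ge 1$, $$c_n=\sum_{\pi\in\Pi_n^{\mathrm{conn}}}\kappa_\pi,\qquad h_n=\sum_{\pi\in\Pi_n^{\mathrm{irr}}}\kappa_\pi=\sum_{\pi\in NC_n^{\mathrm{irr}}}c_\pi .$$ -/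

import Mathlib

open scoped PowerSeries

section GeneratingFunctions

variable {R : Type*} [CommRing R]

/-- The ordinary moment generating function `M(z) = 1 + ∑_{n ≥ 1} m_n z^n`. A moment sequence is
normalised by `m_0 = 1`; the value `m 0` is never used. -/
noncomputable def momentSeries (m : ℕ → R) : R⟦X⟧ :=
  PowerSeries.mk fun n => if n = 0 then 1 else m n

/-- The exponential moment generating function `F(z) = 1 + ∑_{n ≥ 1} (m_n / n!) z^n`. -/
noncomputable def expMomentSeries [Algebra ℚ R] (m : ℕ → R) : R⟦X⟧ :=
  PowerSeries.mk fun n => if n = 0 then 1 else algebraMap ℚ R (1 / (n.factorial : ℚ)) * m n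

/-- The classical cumulants: `κ_n` is `n!` times the coefficient of `z^n` in the formal
logarithm of `F(z)`. -/
noncomputable def classicalCumulant [Algebra ℚ R] (m : ℕ → R) (n : ℕ) : R :=
  (n.factorial : R) * PowerSeries.coeff n (PowerSeries.logOf (expMomentSeries m))

theorem constantCoeff_momentSeries (m : ℕ → R) :
    PowerSeries.constantCoeff (momentSeries m) = 1 := by
  rw [← PowerSeries.coeff_zero_eq_constantCoeff_apply]
  simp [momentSeries]

/-- The series `H(z)` with `M(z) = 1 / (1 - H(z))`. -/
noncomputable def booleanSeries (m : ℕ → R) : R⟦X⟧ :=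
  1 - PowerSeries.invOfUnit (momentSeries m) 1

theorem momentSeries_mul_one_sub_booleanSeries (m : ℕ → R) :
    momentSeries m * (1 - booleanSeries m) = 1 := by
  rw [booleanSeries, sub_sub_cancel]
  exact PowerSeries.mul_invOfUnit _ _ (by simp [constantCoeff_momentSeries])

/-- The boolean cumulants `h_n`, the coefficients of `H(z)`. -/
noncomputable def booleanCumulant (m : ℕ → R) (n : ℕ) : R :=
  PowerSeries.coeff n (booleanSeries m)

theorem coeff_subst_X_mul (C M : R⟦X⟧) (n : ℕ) :
    PowerSeries.coeff n (C.subst (PowerSeries.X * M)) =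
      ∑ d ∈ Finset.range (n + 1),
        PowerSeries.coeff d C * PowerSeries.coeff n ((PowerSeries.X * M) ^ d) := by
  have hs : PowerSeries.HasSubst (PowerSeries.X * M) :=
    PowerSeries.HasSubst.of_constantCoeff_zero' (by simp)
  rw [PowerSeries.coeff_subst' hs]
  rw [finsum_eq_sum_of_support_subset (s := Finset.range (n + 1))]
  · simp [smul_eq_mul]
  · intro d hd
    by_contra hlt
    apply hd
    have hnd : n < d := by simpa using hlt
    simp only [mul_pow, PowerSeries.coeff_X_pow_mul', if_neg (not_le.mpr hnd), smul_zero]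

/-- Auxiliary recursion used to solve `M(z) = C(z M(z))` for `C`. -/
noncomputable def freeCoeffAux (M : R⟦X⟧) : ℕ → R
  | n => PowerSeries.coeff n M - ∑ d : Fin n,
      freeCoeffAux M d.1 * PowerSeries.coeff n ((PowerSeries.X * M) ^ d.1)
  decreasing_by exact d.2

/-- For every moment sequence the equation `C(z M(z)) = M(z)` has exactly one solution `C` with
constant term `1`. -/
theorem existsUnique_freeSeries (m : ℕ → R) :
    ∃! C : R⟦X⟧, PowerSeries.constantCoeff C = 1 ∧
      C.subst (PowerSeries.X * momentSeries m) = momentSeries m := by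
  have hM := constantCoeff_momentSeries m
  set M := momentSeries m
  have hdiag (n : ℕ) : PowerSeries.coeff n ((PowerSeries.X * M) ^ n) = 1 := by
    rw [mul_pow, PowerSeries.coeff_X_pow_mul']
    simp [hM]
  have key (C : R⟦X⟧) : C.subst (PowerSeries.X * M) = M ↔
      ∀ n, PowerSeries.coeff n C = PowerSeries.coeff n M - ∑ d : Fin n,
        PowerSeries.coeff d.1 C * PowerSeries.coeff n ((PowerSeries.X * M) ^ d.1) := by
    rw [PowerSeries.ext_iff]
    refine forall_congr' fun n => ?_
    rw [coeff_subst_X_mul, Finset.sum_range_succ, hdiag, mul_one,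
      Fin.sum_univ_eq_sum_range (fun d => PowerSeries.coeff d C *
        PowerSeries.coeff n ((PowerSeries.X * M) ^ d)) n, eq_sub_iff_add_eq, add_comm]
  refine ⟨PowerSeries.mk (freeCoeffAux M), ⟨?_, ?_⟩, ?_⟩
  · rw [← PowerSeries.coeff_zero_eq_constantCoeff_apply, PowerSeries.coeff_mk, freeCoeffAux]
    simp [hM]
  · rw [key]
    intro n
    simp only [PowerSeries.coeff_mk]
    rw [freeCoeffAux]
  · rintro C ⟨-, hC⟩
    rw [key] at hC
    ext n
    induction n using Nat.strong_induction_on with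
    | _ n ih =>
      rw [hC n, PowerSeries.coeff_mk, freeCoeffAux]
      congr 1
      refine Finset.sum_congr rfl fun d _ => ?_
      rw [ih d.1 d.2, PowerSeries.coeff_mk]

/-- The series `C(z) = 1 + ∑_{n ≥ 1} c_n z^n` defined implicitly by `M(z) = C(z M(z))`. -/
noncomputable def freeSeries (m : ℕ → R) : R⟦X⟧ :=
  (existsUnique_freeSeries m).choose

theorem freeSeries_spec (m : ℕ → R) :
    PowerSeries.constantCoeff (freeSeries m) = 1 ∧
      (freeSeries m).subst (PowerSeries.X * momentSeries m) = momentSeries m :=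
  (existsUnique_freeSeries m).choose_spec.1

/-- The free cumulants `c_n`, the coefficients of `C(z)`. -/
noncomputable def freeCumulant (m : ℕ → R) (n : ℕ) : R :=
  PowerSeries.coeff n (freeSeries m)

end GeneratingFunctions

section Partitions

/-- The partitions of `[n] = {1, …, n}`. -/
abbrev SetPartition (n : ℕ) : Type := Finpartition (Finset.Icc 1 n)

/-- There are `a, c ∈ A` and `b, d ∈ B` with `a < b < c < d`. -/
def Crosses (A B : Finset ℕ) : Prop :=
  ∃ a ∈ A, ∃ b ∈ B, ∃ c ∈ A, ∃ d ∈ B, a < b ∧ b < c ∧ c < d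

namespace SetPartition

variable {n : ℕ}

/-- No two distinct blocks cross. -/
def IsNoncrossing (π : SetPartition n) : Prop :=
  ∀ A ∈ π.parts, ∀ B ∈ π.parts, A ≠ B → ¬ Crosses A B

/-- No proper (nonempty) subinterval of `[n]` is a union of blocks. -/
def IsConnected (π : SetPartition n) : Prop :=
  ∀ a b : ℕ, 1 ≤ a → a ≤ b → b ≤ n → Finset.Icc a b ≠ Finset.Icc 1 n →
    ¬ ∃ T ⊆ π.parts, T.sup id = Finset.Icc a b

/-- Two blocks lie in the same connected component: they are related by the equivalence
relation on blocks that is generated by crossing. -/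
def SameComponent (π : SetPartition n) (A B : Finset ℕ) : Prop :=
  Relation.EqvGen (fun A B => A ∈ π.parts ∧ B ∈ π.parts ∧ Crosses A B) A B

/-- The elements `1` and `n` lie in the same connected component. -/
def IsIrreducible (π : SetPartition n) : Prop :=
  ∃ A ∈ π.parts, ∃ B ∈ π.parts, 1 ∈ A ∧ n ∈ B ∧ π.SameComponent A B

/-- The multiplicative extension `f_π = ∏_{B ∈ π} f_{|B|}` of a sequence `f`. -/
def multiplicative {R : Type*} [CommRing R] (f : ℕ → R) (π : SetPartition n) : R :=
  ∏ B ∈ π.parts, f B.card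

end SetPartition

open Classical in
/-- The connected partitions of `[n]`. -/
noncomputable def connectedPartitions (n : ℕ) : Finset (SetPartition n) :=
  Finset.univ.filter fun π => π.IsConnected

open Classical in
/-- The irreducible partitions of `[n]`. -/
noncomputable def irreduciblePartitions (n : ℕ) : Finset (SetPartition n) :=
  Finset.univ.filter fun π => π.IsIrreducible

open Classical in
/-- The irreducible noncrossing partitions of `[n]`. -/
noncomputable def irreducibleNoncrossingPartitions (n : ℕ) : Finset (SetPartition n) :=
  Finset.univ.filter fun π => π.IsNoncrossing ∧ π.IsIrreducible

end Partitions

/-! All three identities come from one decomposition, valid for any weight on partitions that is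
multiplicative when a partition is inserted into a gap of another (`IsGapMultiplicative`). Call a
set saturated if it is a union of blocks. Let `T` be the series of total weights.

For the free side, cut out the largest saturated interval directly after `k`, for `k = 1, 2, ...` in
turn. With `U_k` the series of partitions in which no saturated interval separates elements of
`[k]`, and `a_k` the weight of the connected partitions of `[k]`, this gives `U_k = T (a_k + X
U_{k+1})`. Since `T = 1 + X U_1`, iteration yields `T = A(X T)` with `A = ∑ a_k X^k`
(`subst_connectedSeries`). For the boolean side, cutting out the largest proper saturated initial
segment gives `T = 1 + T G`, where `G` counts partitions without such a segment (`totalSeries_mul`);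
these are the irreducible ones (`isIrreducible_iff`).

Two weights have `T = M`. For `κ_π` this is the moment-cumulant formula. For `c_π` restricted to
noncrossing partitions, the only connected noncrossing partition has a single block, so `A = C`, and
`M = C(z M)` determines `M`. Uniqueness of `C` and of `H` then gives the theorem. -/

/-! ### Partitions as families of blocks, and insertion into a gap. -/

/-- `P` is the set of blocks of a partition of `s`. -/
def IsPart (s : Finset ℕ) (P : Finset (Finset ℕ)) : Prop :=
  (∀ B ∈ P, B.Nonempty) ∧ (∀ B ∈ P, B ⊆ s) ∧ (∀ x ∈ s, ∃ B ∈ P, x ∈ B) ∧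
    ∀ B ∈ P, ∀ C ∈ P, ∀ x, x ∈ B → x ∈ C → B = C

open Classical in
/-- The set of partitions of `s`, each given by its set of blocks. -/
noncomputable def partsOf (s : Finset ℕ) : Finset (Finset (Finset ℕ)) :=
  s.powerset.powerset.filter (IsPart s)

theorem mem_partsOf {s : Finset ℕ} {P : Finset (Finset ℕ)} : P ∈ partsOf s ↔ IsPart s P := by
  simp only [partsOf, Finset.mem_filter, Finset.mem_powerset, and_iff_right_iff_imp]
  intro h B hB
  exact Finset.mem_powerset.2 (h.2.1 B hB)

/-- `t` contains every block that it meets. -/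
def Saturated (P : Finset (Finset ℕ)) (t : Finset ℕ) : Prop :=
  ∀ B ∈ P, ∀ x ∈ B, ∀ y ∈ B, x ∈ t → y ∈ t

/-- The increasing embedding whose image omits exactly the interval `(k, k + j]`. -/
def gapEmb (k j : ℕ) : ℕ ↪ ℕ where
  toFun x := if x ≤ k then x else x + j
  inj' x y h := by
    simp only at h
    split_ifs at h <;> omega

theorem gapEmb_apply (k j x : ℕ) : gapEmb k j x = if x ≤ k then x else x + j := rfl

/-- The image of a family of sets under an embedding. -/
def mapBlocks (e : ℕ ↪ ℕ) (P : Finset (Finset ℕ)) : Finset (Finset ℕ) :=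
  P.map (Finset.mapEmbedding e).toEmbedding

theorem mem_mapBlocks {e : ℕ ↪ ℕ} {P : Finset (Finset ℕ)} {B : Finset ℕ} :
    B ∈ mapBlocks e P ↔ ∃ A ∈ P, A.map e = B := by
  simp [mapBlocks]

/-- Insert the partition `P₁` as a gap of length `j` after the element `k` of the ground set
of the partition `P₂`. -/
def cut (k j : ℕ) (P₁ P₂ : Finset (Finset ℕ)) : Finset (Finset ℕ) :=
  mapBlocks (addRightEmbedding k) P₁ ∪ mapBlocks (gapEmb k j) P₂

theorem mem_cut {k j : ℕ} {P₁ P₂ : Finset (Finset ℕ)} {B : Finset ℕ} :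
    B ∈ cut k j P₁ P₂ ↔ (∃ A ∈ P₁, A.map (addRightEmbedding k) = B) ∨
      ∃ A ∈ P₂, A.map (gapEmb k j) = B := by
  simp [cut, mem_mapBlocks]

theorem saturated_cut {k j : ℕ} {P₁ P₂ : Finset (Finset ℕ)} {t : Finset ℕ} :
    Saturated (cut k j P₁ P₂) t ↔
      (∀ A ∈ P₁, ∀ x ∈ A, ∀ y ∈ A, x + k ∈ t → y + k ∈ t) ∧
      (∀ A ∈ P₂, ∀ x ∈ A, ∀ y ∈ A, gapEmb k j x ∈ t → gapEmb k j y ∈ t) := by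
  constructor
  · intro h
    refine ⟨fun A hA x hx y hy hxt => ?_, fun A hA x hx y hy hxt => ?_⟩
    · exact h _ (mem_cut.2 (Or.inl ⟨A, hA, rfl⟩)) _ (Finset.mem_map_of_mem (addRightEmbedding k) hx)
        _ (Finset.mem_map_of_mem (addRightEmbedding k) hy) hxt
    · exact h _ (mem_cut.2 (Or.inr ⟨A, hA, rfl⟩)) _ (Finset.mem_map_of_mem _ hx) _
        (Finset.mem_map_of_mem _ hy) hxt
  · rintro ⟨h1, h2⟩ B hB x hx y hy hxt
    rcases mem_cut.1 hB with ⟨A, hA, rfl⟩ | ⟨A, hA, rfl⟩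
    · obtain ⟨x, hxA, rfl⟩ := Finset.mem_map.1 hx
      obtain ⟨y, hyA, rfl⟩ := Finset.mem_map.1 hy
      exact h1 A hA x hxA y hyA hxt
    · obtain ⟨x, hxA, rfl⟩ := Finset.mem_map.1 hx
      obtain ⟨y, hyA, rfl⟩ := Finset.mem_map.1 hy
      exact h2 A hA x hxA y hyA hxt

theorem shift_ne_gap {k j N : ℕ} {P₁ P₂ : Finset (Finset ℕ)} (h₁ : IsPart (Finset.Icc 1 j) P₁)
    (h₂ : IsPart (Finset.Icc 1 N) P₂) {A B : Finset ℕ} (hA : A ∈ P₁) (hB : B ∈ P₂) (x : ℕ)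
    (hx : x ∈ A.map (addRightEmbedding k)) (hx' : x ∈ B.map (gapEmb k j)) : False := by
  obtain ⟨y, hy, rfl⟩ := Finset.mem_map.1 hx
  obtain ⟨z, hz, h⟩ := Finset.mem_map.1 hx'
  have := Finset.mem_Icc.1 (h₁.2.1 A hA hy)
  have := Finset.mem_Icc.1 (h₂.2.1 B hB hz)
  rw [gapEmb_apply] at h
  simp only [addRightEmbedding_apply] at h
  split_ifs at h <;> omega

theorem isPart_cut {k j N : ℕ} (hk : k ≤ N) {P₁ P₂ : Finset (Finset ℕ)}
    (h₁ : IsPart (Finset.Icc 1 j) P₁) (h₂ : IsPart (Finset.Icc 1 N) P₂) :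
    IsPart (Finset.Icc 1 (N + j)) (cut k j P₁ P₂) := by
  refine ⟨fun B hB => ?_, fun B hB x hx => ?_, fun x hx => ?_, fun B hB C hC x hx hx' => ?_⟩
  · rcases mem_cut.1 hB with ⟨A, hA, rfl⟩ | ⟨A, hA, rfl⟩
    · simpa using h₁.1 A hA
    · simpa using h₂.1 A hA
  · rcases mem_cut.1 hB with ⟨A, hA, rfl⟩ | ⟨A, hA, rfl⟩
    · obtain ⟨x, hxA, rfl⟩ := Finset.mem_map.1 hx
      have := Finset.mem_Icc.1 (h₁.2.1 A hA hxA)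
      simp only [addRightEmbedding_apply, Finset.mem_Icc]
      omega
    · obtain ⟨x, hxA, rfl⟩ := Finset.mem_map.1 hx
      have := Finset.mem_Icc.1 (h₂.2.1 A hA hxA)
      rw [gapEmb_apply, Finset.mem_Icc]
      split_ifs <;> omega
  · rw [Finset.mem_Icc] at hx
    by_cases h : k < x ∧ x ≤ k + j
    · obtain ⟨A, hA, hxA⟩ := h₁.2.2.1 (x - k) (by rw [Finset.mem_Icc]; omega)
      refine ⟨_, mem_cut.2 (Or.inl ⟨A, hA, rfl⟩), Finset.mem_map.2 ⟨x - k, hxA, ?_⟩⟩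
      simp only [addRightEmbedding_apply]
      omega
    · obtain ⟨A, hA, hxA⟩ := h₂.2.2.1 (if x ≤ k then x else x - j)
        (by rw [Finset.mem_Icc]; split_ifs <;> omega)
      refine ⟨_, mem_cut.2 (Or.inr ⟨A, hA, rfl⟩), Finset.mem_map.2 ⟨_, hxA, ?_⟩⟩
      rw [gapEmb_apply]
      split_ifs <;> omega
  · rcases mem_cut.1 hB with ⟨A, hA, rfl⟩ | ⟨A, hA, rfl⟩ <;>
      rcases mem_cut.1 hC with ⟨D, hD, rfl⟩ | ⟨D, hD, rfl⟩
    · obtain ⟨y, hy, rfl⟩ := Finset.mem_map.1 hx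
      rw [h₁.2.2.2 A hA D hD y hy ((Finset.mem_map' _).1 hx')]
    · exact (shift_ne_gap h₁ h₂ hA hD x hx hx').elim
    · exact (shift_ne_gap h₁ h₂ hD hA x hx' hx).elim
    · obtain ⟨y, hy, rfl⟩ := Finset.mem_map.1 hx
      rw [h₂.2.2.2 A hA D hD y hy ((Finset.mem_map' _).1 hx')]

theorem saturated_cut_gap {k j N : ℕ} {P₁ P₂ : Finset (Finset ℕ)}
    (h₁ : IsPart (Finset.Icc 1 j) P₁) (h₂ : IsPart (Finset.Icc 1 N) P₂) :
    Saturated (cut k j P₁ P₂) (Finset.Ioc k (k + j)) := by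
  refine saturated_cut.2 ⟨fun A hA x hx y hy _ => ?_, fun A hA x hx y hy h => ?_⟩
  · have := Finset.mem_Icc.1 (h₁.2.1 A hA hy)
    rw [Finset.mem_Ioc]
    omega
  · have := Finset.mem_Icc.1 (h₂.2.1 A hA hx)
    rw [gapEmb_apply, Finset.mem_Ioc] at h
    split_ifs at h <;> omega

theorem cut_injective {k j N : ℕ} {P₁ P₂ Q₁ Q₂ : Finset (Finset ℕ)}
    (h₁ : IsPart (Finset.Icc 1 j) P₁) (h₂ : IsPart (Finset.Icc 1 N) P₂)
    (g₁ : IsPart (Finset.Icc 1 j) Q₁) (g₂ : IsPart (Finset.Icc 1 N) Q₂)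
    (h : cut k j P₁ P₂ = cut k j Q₁ Q₂) : P₁ ⊆ Q₁ ∧ P₂ ⊆ Q₂ := by
  constructor
  · intro A hA
    have hm : A.map (addRightEmbedding k) ∈ cut k j Q₁ Q₂ :=
      h ▸ mem_cut.2 (Or.inl ⟨A, hA, rfl⟩)
    rcases mem_cut.1 hm with ⟨D, hD, e⟩ | ⟨D, hD, e⟩
    · rwa [← Finset.map_injective _ e]
    · obtain ⟨x, hx⟩ := h₁.1 A hA
      have hx := Finset.mem_map_of_mem (addRightEmbedding k) hx
      exact (shift_ne_gap h₁ g₂ hA hD _ hx (e ▸ hx)).elim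
  · intro A hA
    have hm : A.map (gapEmb k j) ∈ cut k j Q₁ Q₂ :=
      h ▸ mem_cut.2 (Or.inr ⟨A, hA, rfl⟩)
    rcases mem_cut.1 hm with ⟨D, hD, e⟩ | ⟨D, hD, e⟩
    · obtain ⟨x, hx⟩ := h₂.1 A hA
      have hx := Finset.mem_map_of_mem (gapEmb k j) hx
      exact (shift_ne_gap g₁ h₂ hD hA _ (e ▸ hx) hx).elim
    · rwa [← Finset.map_injective _ e]

/-- The blocks of `P` that lie in the image of `s` under `e`, pulled back to `s`. -/
def comapBlocks (e : ℕ ↪ ℕ) (s : Finset ℕ) (P : Finset (Finset ℕ)) : Finset (Finset ℕ) :=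
  s.powerset.filter fun A => A.map e ∈ P

theorem mem_comapBlocks {e : ℕ ↪ ℕ} {s : Finset ℕ} {P : Finset (Finset ℕ)} {A : Finset ℕ} :
    A ∈ comapBlocks e s P ↔ A ⊆ s ∧ A.map e ∈ P := by
  simp [comapBlocks]

theorem exists_map_eq {e : ℕ ↪ ℕ} {s B : Finset ℕ} (h : B ⊆ s.map e) :
    ∃ A ⊆ s, A.map e = B := by
  obtain ⟨A, hA, rfl⟩ := Finset.subset_map_iff.1 h
  exact ⟨A, hA, rfl⟩

theorem isPart_comapBlocks {e : ℕ ↪ ℕ} {s t : Finset ℕ} {P : Finset (Finset ℕ)}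
    (hP : IsPart t P) (hs : s.map e ⊆ t) (hsat : Saturated P (s.map e)) :
    IsPart s (comapBlocks e s P) := by
  refine ⟨fun B hB => ?_, fun B hB => (mem_comapBlocks.1 hB).1, fun x hx => ?_,
    fun B hB C hC x hx hx' => ?_⟩
  · simpa using hP.1 _ (mem_comapBlocks.1 hB).2
  · have hx' := Finset.mem_map_of_mem e hx
    obtain ⟨B, hB, hxB⟩ := hP.2.2.1 _ (hs hx')
    obtain ⟨A, hA, rfl⟩ := exists_map_eq (fun y hy => hsat B hB _ hxB y hy hx')
    exact ⟨A, mem_comapBlocks.2 ⟨hA, hB⟩, (Finset.mem_map' e).1 hxB⟩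
  · exact Finset.map_injective e (hP.2.2.2 _ (mem_comapBlocks.1 hB).2 _ (mem_comapBlocks.1 hC).2 _
      (Finset.mem_map_of_mem e hx) (Finset.mem_map_of_mem e hx'))

theorem Saturated.sdiff {P : Finset (Finset ℕ)} {s t : Finset ℕ} (hP : IsPart s P)
    (ht : Saturated P t) : Saturated P (s \ t) := by
  intro B hB x hx y hy h
  rw [Finset.mem_sdiff] at h ⊢
  exact ⟨hP.2.1 B hB hy, fun hyt => h.2 (ht B hB y hy x hx hyt)⟩

theorem map_shift_Icc (k j : ℕ) :
    (Finset.Icc 1 j).map (addRightEmbedding k) = Finset.Ioc k (k + j) := by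
  ext x
  simp only [Finset.mem_map, Finset.mem_Icc, addRightEmbedding_apply, Finset.mem_Ioc]
  constructor
  · rintro ⟨y, hy, rfl⟩
    omega
  · intro h
    exact ⟨x - k, by omega, by omega⟩

theorem map_gap_Icc {k j N : ℕ} (hk : k ≤ N) :
    (Finset.Icc 1 N).map (gapEmb k j) = Finset.Icc 1 (N + j) \ Finset.Ioc k (k + j) := by
  ext x
  simp only [Finset.mem_map, Finset.mem_Icc, gapEmb_apply, Finset.mem_Ioc, Finset.mem_sdiff]
  constructor
  · rintro ⟨y, hy, rfl⟩
    split_ifs <;> omega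
  · intro h
    refine ⟨if x ≤ k then x else x - j, ?_, ?_⟩ <;> split_ifs <;> omega

theorem exists_eq_cut {k j N : ℕ} (hk : k ≤ N) {P : Finset (Finset ℕ)}
    (hP : IsPart (Finset.Icc 1 (N + j)) P) (hsat : Saturated P (Finset.Ioc k (k + j))) :
    ∃ P₁ P₂, IsPart (Finset.Icc 1 j) P₁ ∧ IsPart (Finset.Icc 1 N) P₂ ∧ cut k j P₁ P₂ = P := by
  have e1 := map_shift_Icc k j
  have e2 := map_gap_Icc (j := j) hk
  have hsat2 := hsat.sdiff hP
  refine ⟨comapBlocks (addRightEmbedding k) (Finset.Icc 1 j) P,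
    comapBlocks (gapEmb k j) (Finset.Icc 1 N) P, isPart_comapBlocks hP ?_ ?_,
    isPart_comapBlocks hP ?_ ?_, ?_⟩
  · rw [e1]
    intro x
    simp only [Finset.mem_Ioc, Finset.mem_Icc]
    omega
  · rwa [e1]
  · rw [e2]
    exact Finset.sdiff_subset
  · rwa [e2]
  · ext B
    rw [mem_cut]
    constructor
    · rintro (⟨A, hA, rfl⟩ | ⟨A, hA, rfl⟩)
      · exact (mem_comapBlocks.1 hA).2
      · exact (mem_comapBlocks.1 hA).2
    · intro hB
      obtain ⟨x, hx⟩ := hP.1 B hB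
      by_cases hxI : x ∈ Finset.Ioc k (k + j)
      · obtain ⟨A, hA, rfl⟩ := exists_map_eq (e := addRightEmbedding k) (s := Finset.Icc 1 j)
          (fun y hy => e1 ▸ hsat B hB x hx y hy hxI)
        exact Or.inl ⟨A, mem_comapBlocks.2 ⟨hA, hB⟩, rfl⟩
      · obtain ⟨A, hA, rfl⟩ := exists_map_eq (e := gapEmb k j) (s := Finset.Icc 1 N)
          (fun y hy => e2 ▸ hsat2 B hB x hx y hy
            (Finset.mem_sdiff.2 ⟨hP.2.1 B hB hx, hxI⟩))
        exact Or.inr ⟨A, mem_comapBlocks.2 ⟨hA, hB⟩, rfl⟩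

/-- A sum over the partitions for which `(k, k + j]` is saturated, as a double sum over
the partitions of that interval and of its complement. -/
theorem sum_saturated_eq {R : Type*} [AddCommMonoid R] {k j N : ℕ} (hk : k ≤ N)
    (c : Finset (Finset ℕ) → Prop) [DecidablePred c]
    (hc : ∀ P, c P → Saturated P (Finset.Ioc k (k + j)))
    (c' : Finset (Finset ℕ) → Prop) [DecidablePred c']
    (hcc : ∀ P₁ P₂, IsPart (Finset.Icc 1 j) P₁ → IsPart (Finset.Icc 1 N) P₂ →
      (c (cut k j P₁ P₂) ↔ c' P₂))
    (w : Finset (Finset ℕ) → R) :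
    ∑ P ∈ (partsOf (Finset.Icc 1 (N + j))).filter c, w P =
      ∑ P₁ ∈ partsOf (Finset.Icc 1 j), ∑ P₂ ∈ (partsOf (Finset.Icc 1 N)).filter c',
        w (cut k j P₁ P₂) := by
  rw [← Finset.sum_product']
  symm
  refine Finset.sum_bij (fun p _ => cut k j p.1 p.2) ?_ ?_ ?_ (fun _ _ => rfl)
  · rintro ⟨P₁, P₂⟩ h
    simp only [Finset.mem_product, Finset.mem_filter, mem_partsOf] at h ⊢
    exact ⟨isPart_cut hk h.1 h.2.1, (hcc _ _ h.1 h.2.1).2 h.2.2⟩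
  · rintro ⟨P₁, P₂⟩ h ⟨Q₁, Q₂⟩ g e
    simp only [Finset.mem_product, Finset.mem_filter, mem_partsOf] at h g
    have a := cut_injective h.1 h.2.1 g.1 g.2.1 e
    have b := cut_injective g.1 g.2.1 h.1 h.2.1 e.symm
    exact Prod.ext (a.1.antisymm b.1) (a.2.antisymm b.2)
  · intro P h
    simp only [Finset.mem_filter, mem_partsOf] at h
    obtain ⟨P₁, P₂, h1, h2, rfl⟩ := exists_eq_cut hk h.1 (hc P h.2)
    refine ⟨(P₁, P₂), ?_, rfl⟩
    simp only [Finset.mem_product, Finset.mem_filter, mem_partsOf]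
    exact ⟨h1, h2, (hcc _ _ h1 h2).1 h.2⟩

/-! ### Maximal saturated intervals and their removal. -/

/-- `j` is the largest length, at most `L`, of a saturated interval starting after `k`. -/
def IsMaxGap (k L j : ℕ) (P : Finset (Finset ℕ)) : Prop :=
  Saturated P (Finset.Ioc k (k + j)) ∧
    ∀ i, j < i → i ≤ L → ¬ Saturated P (Finset.Ioc k (k + i))

open Classical in
theorem sum_eq_sum_isMaxGap {R : Type*} [AddCommMonoid R] (S : Finset (Finset (Finset ℕ)))
    (k L : ℕ) (w : Finset (Finset ℕ) → R) :
    ∑ P ∈ S, w P = ∑ j ∈ Finset.range (L + 1), ∑ P ∈ S.filter (IsMaxGap k L j), w P := by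
  let g : Finset (Finset ℕ) → ℕ := fun P =>
    Nat.findGreatest (fun i => Saturated P (Finset.Ioc k (k + i))) L
  rw [← Finset.sum_fiberwise_of_maps_to (g := g) (t := Finset.range (L + 1))
    (fun P _ => Finset.mem_range.2 (Nat.lt_succ_of_le (Nat.findGreatest_le L)))]
  refine Finset.sum_congr rfl fun j hj => Finset.sum_congr ?_ fun _ _ => rfl
  refine Finset.filter_congr fun P _ => ?_
  have hj : j ≤ L := Nat.lt_succ_iff.1 (Finset.mem_range.1 hj)
  rw [Nat.findGreatest_eq_iff]
  constructor
  · rintro ⟨-, h1, h2⟩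
    refine ⟨?_, fun i hi hi' => h2 hi hi'⟩
    -- `Nat.findGreatest` also returns `0` when no length works, which is consistent because the
    -- empty interval is always saturated.
    rcases Nat.eq_zero_or_pos j with rfl | h0
    · intro B _ x _ y _ hx
      simp at hx
    · exact h1 h0.ne'
  · rintro ⟨h1, h2⟩
    exact ⟨hj, fun _ => h1, fun i hi hi' => h2 i hi hi'⟩

/-- No saturated subinterval of `[N]` separates two elements of `[k]`. -/
def Unsplit (k N : ℕ) (P : Finset (Finset ℕ)) : Prop :=
  ∀ a b, a < b → b ≤ N → Saturated P (Finset.Ioc a b) → a < k → a = 0 ∧ k ≤ b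

/-- No proper initial segment of `[N]` is saturated. -/
def NoInitial (N : ℕ) (P : Finset (Finset ℕ)) : Prop :=
  ∀ b, 0 < b → b < N → ¬ Saturated P (Finset.Ioc 0 b)

/-- An interval with both endpoints in the image of `gapEmb` contains the inserted gap or misses it,
so the blocks of `P₁` impose no condition. -/
theorem saturated_cut_Ioc {k j : ℕ} {P₁ P₂ : Finset (Finset ℕ)}
    (h₁ : IsPart (Finset.Icc 1 j) P₁) {a b : ℕ} :
    Saturated (cut k j P₁ P₂) (Finset.Ioc (gapEmb k j a) (gapEmb k j b)) ↔
      Saturated P₂ (Finset.Ioc a b) := by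
  have key : ∀ x, gapEmb k j x ∈ Finset.Ioc (gapEmb k j a) (gapEmb k j b) ↔
      x ∈ Finset.Ioc a b := by
    intro x
    simp only [Finset.mem_Ioc, gapEmb_apply]
    split_ifs <;> omega
  rw [saturated_cut]
  simp only [key]
  refine ⟨fun h => h.2, fun h => ⟨fun A hA x hx y hy hxt => ?_, h⟩⟩
  have := Finset.mem_Icc.1 (h₁.2.1 A hA hx)
  have := Finset.mem_Icc.1 (h₁.2.1 A hA hy)
  simp only [Finset.mem_Ioc, gapEmb_apply] at hxt ⊢
  split_ifs at hxt ⊢ <;> omega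

/-- Collapse the interval `(k, k + j]` to the point `k`. -/
def collapse (k j x : ℕ) : ℕ := if x ≤ k then x else if x ≤ k + j then k else x - j

/-- The preimage of an interval under `gapEmb` is the interval between the collapsed endpoints.
Endpoints inside the gap are allowed here, which is why only one implication is available. -/
theorem Saturated.collapse {k j : ℕ} {P₁ P₂ : Finset (Finset ℕ)} {a b : ℕ}
    (h : Saturated (cut k j P₁ P₂) (Finset.Ioc a b)) :
    Saturated P₂ (Finset.Ioc (collapse k j a) (collapse k j b)) := by
  have key : ∀ x, gapEmb k j x ∈ Finset.Ioc a b ↔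
      x ∈ Finset.Ioc (_root_.collapse k j a) (_root_.collapse k j b) := by
    intro x
    simp only [Finset.mem_Ioc, gapEmb_apply, _root_.collapse]
    split_ifs <;> omega
  have := (saturated_cut.1 h).2
  simp only [key] at this
  exact this

/-- Maximality of the gap supplies what is missing for `k + 1`: no saturated interval of `P₂` starts
directly after `k` or, by complementation, equals `(0, k]`. -/
theorem unsplit_isMaxGap_cut {k j N : ℕ} (hk : 1 ≤ k) (hkN : k < N)
    {P₁ P₂ : Finset (Finset ℕ)} (h₁ : IsPart (Finset.Icc 1 j) P₁)
    (h₂ : IsPart (Finset.Icc 1 N) P₂) :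
    Unsplit k (N + j) (cut k j P₁ P₂) ∧ IsMaxGap k (N + j - k) j (cut k j P₁ P₂) ↔
      Unsplit (k + 1) N P₂ := by
  have up : ∀ {a b}, Saturated P₂ (Finset.Ioc a b) →
      Saturated (cut k j P₁ P₂) (Finset.Ioc (gapEmb k j a) (gapEmb k j b)) :=
    fun h => (saturated_cut_Ioc h₁).2 h
  constructor
  · rintro ⟨hU, -, hM⟩ a b hab hb hs ha
    have hs' := up hs
    have hb' : gapEmb k j b = if b ≤ k then b else b + j := rfl
    rcases Nat.lt_succ_iff_lt_or_eq.1 ha with ha | rfl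
    · rw [show gapEmb k j a = a from if_pos ha.le] at hs'
      have hU' := hU _ _ (by rw [hb']; split_ifs <;> omega) (by rw [hb']; split_ifs <;> omega)
        hs' ha
      rw [hb'] at hU' hs'
      refine ⟨hU'.1, ?_⟩
      by_contra hbk
      obtain ⟨rfl, hU'⟩ := hU'
      have hbk : b = k := by split_ifs at hU' <;> omega
      subst hbk
      rw [if_pos le_rfl] at hs'
      -- Here `b = k`: if `(0, k]` is saturated, so is its complement `(k, N + j]`, which is longer
      -- than the gap because `k < N`.
      refine hM (N + j - b) (by omega) le_rfl ?_
      have := hs'.sdiff (isPart_cut hkN.le h₁ h₂)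
      convert this using 1
      ext x
      simp only [Finset.mem_Ioc, Finset.mem_sdiff, Finset.mem_Icc]
      omega
    -- A saturated interval of `P₂` starting at the insertion point would absorb the gap into a
    -- longer saturated interval.
    · rw [hb', if_neg (by omega), show gapEmb a j a = a from if_pos le_rfl] at hs'
      refine (hM (b + j - a) (by omega) (by omega) ?_).elim
      rwa [show a + (b + j - a) = b + j by omega]
  · intro h
    refine ⟨fun a b hab hb hs ha => ?_, saturated_cut_gap h₁ h₂, fun i hi hi' hs => ?_⟩
    · have hs' := hs.collapse
      by_cases hlt : collapse k j a < collapse k j b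
      · have := h _ _ hlt (by unfold collapse; split_ifs <;> omega) hs'
          (by unfold collapse; split_ifs <;> omega)
        unfold collapse at this
        split_ifs at this <;> omega
      · unfold collapse at hlt
        split_ifs at hlt
        all_goals omega
    · have := h _ _ (by unfold collapse; split_ifs <;> omega)
        (by unfold collapse; split_ifs <;> omega) hs.collapse
        (by unfold collapse; split_ifs <;> omega)
      unfold collapse at this
      split_ifs at this <;> omega

/-- The extreme case in which the gap consists of everything after `k`; maximality is then vacuous.
-/
theorem unsplit_cut_self {k j : ℕ}
    {P₁ P₂ : Finset (Finset ℕ)} (h₁ : IsPart (Finset.Icc 1 j) P₁)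
    (h₂ : IsPart (Finset.Icc 1 k) P₂) :
    Unsplit k (k + j) (cut k j P₁ P₂) ∧ IsMaxGap k j j (cut k j P₁ P₂) ↔ Unsplit k k P₂ := by
  constructor
  · rintro ⟨hU, -⟩ a b hab hb hs ha
    have := hU _ _ (by simp only [gapEmb_apply]; split_ifs <;> omega)
      (by
        simp only [gapEmb_apply]
        split_ifs
        omega)
      ((saturated_cut_Ioc (k := k) h₁).2 hs)
      (by simp only [gapEmb_apply]; split_ifs <;> omega)
    simp only [gapEmb_apply] at this
    split_ifs at this <;> omega
  · intro h
    refine ⟨fun a b hab hb hs ha => ?_, saturated_cut_gap h₁ h₂, fun i hi hi' hs => by omega⟩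
    have := h _ _ (by unfold collapse; split_ifs <;> omega)
        (by unfold collapse; split_ifs <;> omega) hs.collapse
        (by unfold collapse; split_ifs <;> omega)
    unfold collapse at this
    split_ifs at this <;> omega

/-- The bound `N + j - 1` excludes the whole ground set. A longer saturated initial segment is the
gap followed by a saturated initial segment of `P₂`. -/
theorem isMaxGap_cut_zero {j N : ℕ}
    {P₁ P₂ : Finset (Finset ℕ)} (h₁ : IsPart (Finset.Icc 1 j) P₁)
    (h₂ : IsPart (Finset.Icc 1 N) P₂) :
    IsMaxGap 0 (N + j - 1) j (cut 0 j P₁ P₂) ↔ NoInitial N P₂ := by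
  constructor
  · rintro ⟨-, hM⟩ b hb0 hb hs
    have := (saturated_cut_Ioc (k := 0) h₁).2 hs
    refine hM (b + j) (by omega) (by omega) ?_
    rwa [gapEmb_apply, gapEmb_apply, if_pos le_rfl, if_neg (by omega), ← Nat.zero_add (b + j)] at this
  · intro h
    refine ⟨saturated_cut_gap h₁ h₂, fun i hi hi' hs => ?_⟩
    refine h (i - j) (by omega) (by omega) ?_
    have e : collapse 0 j (0 + i) = i - j := by unfold collapse; split_ifs <;> omega
    have e0 : collapse 0 j 0 = 0 := rfl
    rw [← e]
    exact hs.collapse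

/-! ### Recursions and functional equations for gap-multiplicative weights. -/

section Weight

variable {R : Type*} [CommRing R]

/-- A weight on set partitions that is normalised and multiplicative under insertion of a
partition into a gap of another one. -/
structure IsGapMultiplicative (w : Finset (Finset ℕ) → R) : Prop where
  empty : w ∅ = 1
  cut : ∀ k j N P₁ P₂, k ≤ N → IsPart (Finset.Icc 1 j) P₁ → IsPart (Finset.Icc 1 N) P₂ →
    w (cut k j P₁ P₂) = w P₁ * w P₂

/-- The total weight of the partitions of `[n]`. -/
noncomputable def totalWeight (w : Finset (Finset ℕ) → R) (n : ℕ) : R :=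
  ∑ P ∈ partsOf (Finset.Icc 1 n), w P

open Classical in
/-- The total weight of the partitions of `[n]` with no saturated interval separating two
elements of `[k]`. -/
noncomputable def unsplitWeight (w : Finset (Finset ℕ) → R) (k n : ℕ) : R :=
  ∑ P ∈ (partsOf (Finset.Icc 1 n)).filter (Unsplit k n), w P

open Classical in
/-- The total weight of the partitions of `[n]` without proper saturated initial segment. -/
noncomputable def noInitialWeight (w : Finset (Finset ℕ) → R) (n : ℕ) : R :=
  ∑ P ∈ (partsOf (Finset.Icc 1 n)).filter (NoInitial n), w P

theorem IsGapMultiplicative.sum_filter {w : Finset (Finset ℕ) → R} (hw : IsGapMultiplicative w)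
    {k j N : ℕ} (hk : k ≤ N)
    (c : Finset (Finset ℕ) → Prop) [DecidablePred c]
    (hc : ∀ P, c P → Saturated P (Finset.Ioc k (k + j)))
    (c' : Finset (Finset ℕ) → Prop) [DecidablePred c']
    (hcc : ∀ P₁ P₂, IsPart (Finset.Icc 1 j) P₁ → IsPart (Finset.Icc 1 N) P₂ →
      (c (_root_.cut k j P₁ P₂) ↔ c' P₂)) :
    ∑ P ∈ (partsOf (Finset.Icc 1 (N + j))).filter c, w P =
      totalWeight w j * ∑ P₂ ∈ (partsOf (Finset.Icc 1 N)).filter c', w P₂ := by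
  rw [sum_saturated_eq hk c hc c' hcc, totalWeight, Finset.sum_mul_sum]
  refine Finset.sum_congr rfl fun P₁ h₁ => Finset.sum_congr rfl fun P₂ h₂ => ?_
  exact hw.cut _ _ _ _ _ hk (mem_partsOf.1 h₁) (mem_partsOf.1 (Finset.mem_filter.1 h₂).1)

/-- The index `j` is the length of the largest saturated interval after `k`; the separate last term
is `j = r`, where only `[k]` remains. -/
theorem IsGapMultiplicative.unsplitWeight_rec {w : Finset (Finset ℕ) → R}
    (hw : IsGapMultiplicative w) {k r : ℕ} (hk : 1 ≤ k) :
    unsplitWeight w k (k + r) =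
      ∑ j ∈ Finset.range r, totalWeight w j * unsplitWeight w (k + 1) (k + r - j) +
        totalWeight w r * unsplitWeight w k k := by
  classical
  rw [unsplitWeight, sum_eq_sum_isMaxGap _ k r, Finset.sum_range_succ]
  congr 1
  · refine Finset.sum_congr rfl fun j hj => ?_
    have hj := Finset.mem_range.1 hj
    rw [Finset.filter_filter]
    obtain ⟨N, hN⟩ : ∃ N, k + r = N + j := ⟨k + r - j, by omega⟩
    obtain rfl : r = N + j - k := by omega
    rw [hN, Nat.add_sub_cancel]
    exact hw.sum_filter (k := k) (by omega)
      (fun P => Unsplit k (N + j) P ∧ IsMaxGap k (N + j - k) j P) (fun P h => h.2.1) _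
      fun P₁ P₂ h₁ h₂ => unsplit_isMaxGap_cut hk (by omega) h₁ h₂
  · rw [Finset.filter_filter]
    exact hw.sum_filter le_rfl
      (fun P => Unsplit k (k + r) P ∧ IsMaxGap k r r P) (fun P h => h.2.1) _
      fun P₁ P₂ h₁ h₂ => unsplit_cut_self h₁ h₂

theorem IsGapMultiplicative.totalWeight_rec {w : Finset (Finset ℕ) → R}
    (hw : IsGapMultiplicative w) {n : ℕ} (hn : 1 ≤ n) :
    totalWeight w n = ∑ j ∈ Finset.range n, totalWeight w j * noInitialWeight w (n - j) := by
  classical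
  rw [totalWeight, sum_eq_sum_isMaxGap _ 0 (n - 1), Nat.sub_add_cancel hn]
  refine Finset.sum_congr rfl fun j hj => ?_
  have hj := Finset.mem_range.1 hj
  obtain ⟨N, rfl⟩ : ∃ N, n = N + j := ⟨n - j, by omega⟩
  rw [Nat.add_sub_cancel]
  exact hw.sum_filter (Nat.zero_le _) _ (fun P h => h.1) _
    fun P₁ P₂ h₁ h₂ => isMaxGap_cut_zero h₁ h₂

theorem partsOf_empty : partsOf ∅ = {∅} := by
  ext P
  rw [mem_partsOf, Finset.mem_singleton]
  constructor
  · intro h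
    refine Finset.eq_empty_of_forall_notMem fun B hB => ?_
    obtain ⟨x, hx⟩ := h.1 B hB
    simpa using h.2.1 B hB hx
  · rintro rfl
    simp [IsPart]

theorem IsGapMultiplicative.totalWeight_zero {w : Finset (Finset ℕ) → R}
    (hw : IsGapMultiplicative w) : totalWeight w 0 = 1 := by
  simp [totalWeight, partsOf_empty, hw.empty]

theorem IsGapMultiplicative.unsplitWeight_zero {w : Finset (Finset ℕ) → R}
    (hw : IsGapMultiplicative w) : unsplitWeight w 0 0 = 1 := by
  classical
  have : Unsplit 0 0 (∅ : Finset (Finset ℕ)) := fun a b _ _ _ h => by omega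
  simp [unsplitWeight, partsOf_empty, hw.empty, Finset.filter_singleton, this]

/-- A single point cannot be separated: `a < 1` already forces `a = 0` and `1 ≤ b`. -/
theorem unsplitWeight_one (w : Finset (Finset ℕ) → R) {n : ℕ} :
    unsplitWeight w 1 n = totalWeight w n := by
  classical
  rw [unsplitWeight, totalWeight, Finset.filter_true_of_mem]
  intro P _ a b hab _ _ ha
  omega

/-- The generating series of the total weights. -/
noncomputable def totalSeries (w : Finset (Finset ℕ) → R) : R⟦X⟧ :=
  PowerSeries.mk (totalWeight w)

/-- The generating series of the weights of the connected partitions. -/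
noncomputable def connectedSeries (w : Finset (Finset ℕ) → R) : R⟦X⟧ :=
  PowerSeries.mk fun n => unsplitWeight w n n

/-- The generating series of the partitions unsplit on `[k]`, by the number of other elements. -/
noncomputable def unsplitSeries (w : Finset (Finset ℕ) → R) (k : ℕ) : R⟦X⟧ :=
  PowerSeries.mk fun r => unsplitWeight w k (k + r)

theorem IsGapMultiplicative.unsplitSeries_eq {w : Finset (Finset ℕ) → R}
    (hw : IsGapMultiplicative w) {k : ℕ} (hk : 1 ≤ k) :
    unsplitSeries w k = totalSeries w *
      (PowerSeries.C (PowerSeries.coeff k (connectedSeries w)) +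
        PowerSeries.X * unsplitSeries w (k + 1)) := by
  ext r
  rw [mul_add, map_add, PowerSeries.coeff_mul_C, add_comm, mul_left_comm,
    unsplitSeries, PowerSeries.coeff_mk, hw.unsplitWeight_rec hk, connectedSeries, totalSeries,
    PowerSeries.coeff_mk, PowerSeries.coeff_mk]
  congr 1
  rcases r with _ | r
  · simp
  · rw [PowerSeries.coeff_succ_X_mul, PowerSeries.coeff_mul,
      Finset.Nat.sum_antidiagonal_eq_sum_range_succ (fun i j =>
        PowerSeries.coeff i (PowerSeries.mk (totalWeight w)) *
          PowerSeries.coeff j (unsplitSeries w (k + 1)))]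
    refine Finset.sum_congr rfl fun j hj => ?_
    have hj := Finset.mem_range.1 hj
    rw [unsplitSeries, PowerSeries.coeff_mk, PowerSeries.coeff_mk]
    congr 2
    omega

/-- Start from `T = 1 + X U_1` and replace the last `U` by `unsplitSeries_eq` again and again; the
remainder is divisible by `X ^ (K + 1)`. -/
theorem IsGapMultiplicative.totalSeries_eq_sum {w : Finset (Finset ℕ) → R}
    (hw : IsGapMultiplicative w) (K : ℕ) :
    totalSeries w = ∑ d ∈ Finset.range (K + 1),
        PowerSeries.C (PowerSeries.coeff d (connectedSeries w)) *
          (PowerSeries.X * totalSeries w) ^ d +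
      (PowerSeries.X * totalSeries w) ^ K * (PowerSeries.X * unsplitSeries w (K + 1)) := by
  induction K with
  | zero =>
    ext n
    rcases n with _ | n
    · simp [totalSeries, connectedSeries, hw.totalWeight_zero, hw.unsplitWeight_zero]
    · simp [totalSeries, unsplitSeries, unsplitWeight_one, PowerSeries.coeff_succ_X_mul,
        add_comm]
  | succ K ih =>
    rw [Finset.sum_range_succ, add_assoc]
    nth_rewrite 1 [ih]
    congr 1
    rw [hw.unsplitSeries_eq (k := K + 1) (by omega)]
    ring

theorem IsGapMultiplicative.subst_connectedSeries {w : Finset (Finset ℕ) → R}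
    (hw : IsGapMultiplicative w) :
    (connectedSeries w).subst (PowerSeries.X * totalSeries w) = totalSeries w := by
  ext n
  rw [coeff_subst_X_mul]
  -- With `K = n` the remainder does not reach the coefficient of degree `n`.
  conv_rhs => rw [hw.totalSeries_eq_sum n]
  rw [map_add, map_sum, mul_pow, mul_assoc, PowerSeries.coeff_X_pow_mul']
  simp [mul_left_comm _ PowerSeries.X]

theorem IsGapMultiplicative.totalSeries_mul {w : Finset (Finset ℕ) → R}
    (hw : IsGapMultiplicative w) (H : R⟦X⟧) (hH : totalSeries w * (1 - H) = 1) {n : ℕ}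
    (hn : 1 ≤ n) : PowerSeries.coeff n H = noInitialWeight w n := by
  -- The constant term must be set to `0`, since `noInitialWeight w 0` is `1` (the empty partition).
  let G : R⟦X⟧ := PowerSeries.mk fun n => if n = 0 then 0 else noInitialWeight w n
  have hG : totalSeries w * (1 - G) = 1 := by
    rw [mul_sub, mul_one, sub_eq_iff_eq_add]
    ext n
    rw [totalSeries, PowerSeries.coeff_mk, map_add, PowerSeries.coeff_mul,
      Finset.Nat.sum_antidiagonal_eq_sum_range_succ (fun i j =>
        PowerSeries.coeff i (PowerSeries.mk (totalWeight w)) * PowerSeries.coeff j G),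
      Finset.sum_range_succ]
    rcases Nat.eq_zero_or_pos n with rfl | h
    · simp [G, hw.totalWeight_zero]
    · rw [hw.totalWeight_rec h]
      simp only [G, PowerSeries.coeff_mk, PowerSeries.coeff_one, h.ne', if_false, Nat.sub_self,
        if_true, mul_zero, add_zero, zero_add]
      refine Finset.sum_congr rfl fun j hj => ?_
      have hj := Finset.mem_range.1 hj
      rw [if_neg (by omega)]
  have e : 1 - H = 1 - G := by
    calc 1 - H = (totalSeries w * (1 - G)) * (1 - H) := by rw [hG, one_mul]
      _ = (totalSeries w * (1 - H)) * (1 - G) := by ring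
      _ = 1 - G := by rw [hH, one_mul]
  rw [sub_right_injective e]
  simp [G, Nat.one_le_iff_ne_zero.1 hn]

end Weight

/-! ### Passage between `Finpartition` and families of blocks. -/

theorem Finpartition.isPart_parts {s : Finset ℕ} (π : Finpartition s) : IsPart s π.parts := by
  refine ⟨fun B hB => π.nonempty_of_mem_parts hB, fun B hB => π.le hB, fun x hx => ?_,
    fun B hB C hC x hx hx' => ?_⟩
  · obtain ⟨t, ht, -⟩ := π.existsUnique_mem hx
    exact ⟨t, ht⟩
  · exact π.eq_of_mem_parts hB hC hx hx'

theorem IsPart.exists_finpartition {s : Finset ℕ} {P : Finset (Finset ℕ)} (h : IsPart s P) :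
    ∃ π : Finpartition s, π.parts = P := by
  refine ⟨⟨P, ?_, ?_, ?_⟩, rfl⟩
  · rw [Finset.supIndep_iff_pairwiseDisjoint]
    intro B hB C hC hBC
    refine Finset.disjoint_left.2 fun x hx hx' => hBC (h.2.2.2 B hB C hC x hx hx')
  · ext x
    rw [Finset.mem_sup]
    constructor
    · rintro ⟨B, hB, hx⟩
      exact h.2.1 B hB hx
    · exact h.2.2.1 x
  · intro hB
    simpa using h.1 _ hB

theorem sum_finpartition_filter {R : Type*} [AddCommMonoid R] {s : Finset ℕ}
    (w : Finset (Finset ℕ) → R) (p : Finpartition s → Prop) [DecidablePred p]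
    (q : Finset (Finset ℕ) → Prop) [DecidablePred q] (hpq : ∀ π, p π ↔ q π.parts) :
    ∑ π ∈ Finset.univ.filter p, w π.parts = ∑ P ∈ (partsOf s).filter q, w P := by
  refine Finset.sum_bij (fun π _ => π.parts) ?_ ?_ ?_ (fun _ _ => rfl)
  · intro π h
    rw [Finset.mem_filter] at h ⊢
    exact ⟨mem_partsOf.2 π.isPart_parts, (hpq π).1 h.2⟩
  · intro π _ ρ _ h
    exact Finpartition.ext h
  · intro P h
    rw [Finset.mem_filter, mem_partsOf] at h
    obtain ⟨π, rfl⟩ := h.1.exists_finpartition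
    exact ⟨π, Finset.mem_filter.2 ⟨Finset.mem_univ _, (hpq π).2 h.2⟩, rfl⟩

/-! ### Multiplicative and noncrossing weights. -/

section Weights

variable {R : Type*} [CommRing R]

/-- The multiplicative weight `f_P` of a family of blocks. -/
def blockWeight (f : ℕ → R) (P : Finset (Finset ℕ)) : R := ∏ B ∈ P, f B.card

theorem blockWeight_mapBlocks (f : ℕ → R) (e : ℕ ↪ ℕ) (P : Finset (Finset ℕ)) :
    blockWeight f (mapBlocks e P) = blockWeight f P := by
  simp [blockWeight, mapBlocks, Finset.prod_map]

theorem blockWeight_cut (f : ℕ → R) {k j N : ℕ} {P₁ P₂ : Finset (Finset ℕ)}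
    (h₁ : IsPart (Finset.Icc 1 j) P₁) (h₂ : IsPart (Finset.Icc 1 N) P₂) :
    blockWeight f (cut k j P₁ P₂) = blockWeight f P₁ * blockWeight f P₂ := by
  rw [← blockWeight_mapBlocks f (addRightEmbedding k) P₁,
    ← blockWeight_mapBlocks f (gapEmb k j) P₂, blockWeight, cut, Finset.prod_union]
  · rfl
  · refine Finset.disjoint_left.2 fun B hB hB' => ?_
    obtain ⟨A, hA, rfl⟩ := mem_mapBlocks.1 hB
    obtain ⟨D, hD, e⟩ := mem_mapBlocks.1 hB'
    obtain ⟨x, hx⟩ := h₁.1 A hA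
    have hx := Finset.mem_map_of_mem (addRightEmbedding k) hx
    exact shift_ne_gap h₁ h₂ hA hD _ hx (e ▸ hx)

theorem isGapMultiplicative_blockWeight (f : ℕ → R) : IsGapMultiplicative (blockWeight f) where
  empty := by simp [blockWeight]
  cut _ _ _ _ _ _ h₁ h₂ := blockWeight_cut f h₁ h₂

/-- No two distinct blocks of `P` cross. -/
def Noncrossing (P : Finset (Finset ℕ)) : Prop :=
  ∀ A ∈ P, ∀ B ∈ P, A ≠ B → ¬ Crosses A B

theorem crosses_map {e : ℕ ↪ ℕ} (he : StrictMono e) {A B : Finset ℕ} :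
    Crosses (A.map e) (B.map e) ↔ Crosses A B := by
  simp only [Crosses, Finset.mem_map, exists_exists_and_eq_and, he.lt_iff_lt]

theorem strictMono_gapEmb (k j : ℕ) : StrictMono (gapEmb k j) := by
  intro x y h
  simp only [gapEmb_apply]
  split_ifs <;> omega

theorem strictMono_shift (k : ℕ) : StrictMono (addRightEmbedding k : ℕ ↪ ℕ) := by
  intro x y h
  simpa using h

/-- A block inside an interval never crosses a block outside it, as a crossing would put an outside
point between two inside points. -/
theorem noncrossing_cut {k j N : ℕ} {P₁ P₂ : Finset (Finset ℕ)}
    (h₁ : IsPart (Finset.Icc 1 j) P₁) (h₂ : IsPart (Finset.Icc 1 N) P₂) :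
    Noncrossing (cut k j P₁ P₂) ↔ Noncrossing P₁ ∧ Noncrossing P₂ := by
  have m1 : ∀ A ∈ P₁, ∀ x ∈ A.map (addRightEmbedding k), k < x ∧ x ≤ k + j := by
    intro A hA x hx
    obtain ⟨y, hy, rfl⟩ := Finset.mem_map.1 hx
    have := Finset.mem_Icc.1 (h₁.2.1 A hA hy)
    simp only [addRightEmbedding_apply]
    omega
  have m2 : ∀ A ∈ P₂, ∀ x ∈ A.map (gapEmb k j), ¬ (k < x ∧ x ≤ k + j) := by
    intro A hA x hx
    obtain ⟨y, hy, rfl⟩ := Finset.mem_map.1 hx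
    have := Finset.mem_Icc.1 (h₂.2.1 A hA hy)
    rw [gapEmb_apply]
    split_ifs <;> omega
  constructor
  · refine fun h => ⟨fun A hA B hB hAB hc => ?_, fun A hA B hB hAB hc => ?_⟩
    · exact h _ (mem_cut.2 (Or.inl ⟨A, hA, rfl⟩)) _ (mem_cut.2 (Or.inl ⟨B, hB, rfl⟩))
        (fun e => hAB (Finset.map_injective _ e)) ((crosses_map (strictMono_shift k)).2 hc)
    · exact h _ (mem_cut.2 (Or.inr ⟨A, hA, rfl⟩)) _ (mem_cut.2 (Or.inr ⟨B, hB, rfl⟩))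
        (fun e => hAB (Finset.map_injective _ e)) ((crosses_map (strictMono_gapEmb k j)).2 hc)
  · rintro ⟨h, h'⟩ A hA B hB hAB hc
    rcases mem_cut.1 hA with ⟨A, hA', rfl⟩ | ⟨A, hA', rfl⟩ <;>
      rcases mem_cut.1 hB with ⟨B, hB', rfl⟩ | ⟨B, hB', rfl⟩
    · exact h A hA' B hB' (fun e => hAB (e ▸ rfl)) ((crosses_map (strictMono_shift k)).1 hc)
    · obtain ⟨a, ha, b, hb, c, hc, d, hd, _⟩ := hc
      have := m1 A hA' a ha
      have := m2 B hB' b hb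
      have := m1 A hA' c hc
      omega
    · obtain ⟨a, ha, b, hb, c, hc, d, hd, _⟩ := hc
      have := m1 B hB' b hb
      have := m2 A hA' c hc
      have := m1 B hB' d hd
      omega
    · exact h' A hA' B hB' (fun e => hAB (e ▸ rfl)) ((crosses_map (strictMono_gapEmb k j)).1 hc)

open Classical in
/-- The multiplicative weight restricted to noncrossing partitions. -/
noncomputable def noncrossingWeight (f : ℕ → R) (P : Finset (Finset ℕ)) : R :=
  if Noncrossing P then blockWeight f P else 0

theorem isGapMultiplicative_noncrossingWeight (f : ℕ → R) :
    IsGapMultiplicative (noncrossingWeight f) where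
  empty := by simp [noncrossingWeight, blockWeight, Noncrossing]
  cut k j N P₁ P₂ _ h₁ h₂ := by
    classical
    simp only [noncrossingWeight, noncrossing_cut h₁ h₂, blockWeight_cut f h₁ h₂]
    split_ifs <;> simp_all

theorem isPart_singleton {n : ℕ} (hn : 1 ≤ n) : IsPart (Finset.Icc 1 n) {Finset.Icc 1 n} := by
  refine ⟨?_, ?_, ?_, ?_⟩
  · simpa using hn
  · simp
  · simp
  · simp

theorem unsplit_singleton {n : ℕ} : Unsplit n n {Finset.Icc 1 n} := by
  intro a b hab hb hs han
  have h1 := hs _ (Finset.mem_singleton_self _) b (Finset.mem_Icc.2 (by omega))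
  have h2 := h1 1 (Finset.mem_Icc.2 (by omega)) (Finset.mem_Ioc.2 (by omega))
  have h3 := h1 n (Finset.mem_Icc.2 (by omega)) (Finset.mem_Ioc.2 (by omega))
  rw [Finset.mem_Ioc] at h2 h3
  omega

/-- The gap around `x` in the complement of `B`, if nonempty and bounded, is an interval. -/
theorem exists_Ioc_gap {n x : ℕ} {B : Finset ℕ} (h1 : 1 ∈ B) (hx : x ∈ Finset.Icc 1 n)
    (hxB : x ∉ B) : ∃ a b, 1 ≤ a ∧ a < b ∧ b ≤ n ∧
      ∀ z, z ∈ Finset.Ioc a b ↔ z ∈ Finset.Icc 1 n ∧ z ∉ B ∧ ∀ y ∈ B, (y < z ↔ y < x) := by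
  rw [Finset.mem_Icc] at hx
  have hx1 : 1 < x := lt_of_le_of_ne hx.1 (fun e => hxB (e ▸ h1))
  let L := B.filter (· < x)
  have hL : L.Nonempty := ⟨1, Finset.mem_filter.2 ⟨h1, hx1⟩⟩
  -- The sentinel `n + 1` is the right boundary when no element of `B` exceeds `x`.
  let U := insert (n + 1) (B.filter (x < ·))
  have hU : U.Nonempty := ⟨n + 1, Finset.mem_insert_self _ _⟩
  have a1 := Finset.mem_filter.1 (L.max'_mem hL)
  have a2 : ∀ y ∈ B, y < x → y ≤ L.max' hL := fun y hy h =>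
    L.le_max' _ (Finset.mem_filter.2 ⟨hy, h⟩)
  have a3 := a2 1 h1 hx1
  have b1 := Finset.mem_insert.1 (U.min'_mem hU)
  have b2 : ∀ y ∈ B, x < y → U.min' hU ≤ y := fun y hy h =>
    U.min'_le _ (Finset.mem_insert_of_mem (Finset.mem_filter.2 ⟨hy, h⟩))
  have b3 : U.min' hU ≤ n + 1 := U.min'_le _ (Finset.mem_insert_self _ _)
  have b4 : x < U.min' hU := by
    rcases b1 with h | h
    · omega
    · exact (Finset.mem_filter.1 h).2
  generalize L.max' hL = a at *
  generalize U.min' hU = b at *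
  refine ⟨a, b - 1, a3, by omega, by omega, fun z => ?_⟩
  rw [Finset.mem_Ioc, Finset.mem_Icc]
  constructor
  · intro hz
    refine ⟨by omega, fun hzB => ?_, fun y hy => ?_⟩
    · rcases lt_trichotomy z x with h | h | h
      · have := a2 z hzB h
        omega
      · exact hxB (h ▸ hzB)
      · have := b2 z hzB h
        omega
    · rcases lt_trichotomy y x with h | h | h
      · have := a2 y hy h
        omega
      · exact (hxB (h ▸ hy)).elim
      · have := b2 y hy h
        omega
  · rintro ⟨hz, hzB, h⟩
    refine ⟨(h a a1.1).2 a1.2, ?_⟩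
    rcases b1 with hb | hb
    · omega
    · have hb := Finset.mem_filter.1 hb
      have := (h b hb.1).1.mt (by omega)
      have : z ≠ b := fun e => hzB (e ▸ hb.1)
      omega

/-- If the block `B` of `1` misses a point, the gap of `B` around that point is an interval. By
noncrossing it is saturated, and it does not contain `1`, contrary to `Unsplit`. -/
theorem eq_singleton_of_noncrossing_of_unsplit {n : ℕ} (hn : 1 ≤ n) {P : Finset (Finset ℕ)}
    (hP : IsPart (Finset.Icc 1 n) P) (hnc : Noncrossing P) (hu : Unsplit n n P) :
    P = {Finset.Icc 1 n} := by
  obtain ⟨B, hB, h1⟩ := hP.2.2.1 1 (Finset.mem_Icc.2 ⟨le_rfl, hn⟩)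
  have hBn : B = Finset.Icc 1 n := by
    refine (hP.2.1 B hB).antisymm fun x hx => ?_
    by_contra hxB
    obtain ⟨a, b, ha, hab, hb, hz⟩ := exists_Ioc_gap h1 hx hxB
    have := hu a b hab hb ?_ (by omega)
    · omega
    · intro C hC z hzC y hyC hzI
      rw [hz] at hzI ⊢
      have hCB : B ≠ C := fun e => hzI.2.1 (e ▸ hzC)
      have hnB : ∀ u ∈ C, u ∉ B := fun u hu hu' => hCB (hP.2.2.2 B hB C hC u hu' hu)
      have hpos : ∀ u ∈ C, 1 < u := fun u hu =>
        lt_of_le_of_ne (Finset.mem_Icc.1 (hP.2.1 C hC hu)).1 (fun e => hnB u hu (e ▸ h1))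
      refine ⟨hP.2.1 C hC hyC, hnB y hyC, fun v hv => ?_⟩
      rw [← hzI.2.2 v hv]
      have hvy : v ≠ y := fun e => hnB y hyC (e ▸ hv)
      have hvz : v ≠ z := fun e => hnB z hzC (e ▸ hv)
      -- An element `v` of `B` between two points of `C` would, together with `1 ∈ B`, make `B` and
      -- `C` cross.
      constructor
      · intro h
        by_contra h'
        exact hnc B hB C hC hCB ⟨1, h1, z, hzC, v, hv, y, hyC, hpos z hzC, by omega, h⟩
      · intro h
        by_contra h'
        exact hnc B hB C hC hCB ⟨1, h1, y, hyC, v, hv, z, hzC, hpos y hyC, by omega, h⟩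
  subst hBn
  refine Finset.eq_singleton_iff_unique_mem.2 ⟨hB, fun C hC => ?_⟩
  obtain ⟨x, hx⟩ := hP.1 C hC
  exact hP.2.2.2 C hC _ hB x hx (hP.2.1 C hC hx)

theorem unsplitWeight_noncrossingWeight (f : ℕ → R) {n : ℕ} (hn : 1 ≤ n) :
    unsplitWeight (noncrossingWeight f) n n = f n := by
  classical
  rw [unsplitWeight, Finset.sum_eq_single {Finset.Icc 1 n}]
  · have : Noncrossing {Finset.Icc 1 n} := by
      intro A hA B hB h
      rw [Finset.mem_singleton] at hA hB
      exact (h (hA.trans hB.symm)).elim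
    simp [noncrossingWeight, this, blockWeight]
  · intro P hP hne
    rw [Finset.mem_filter, mem_partsOf] at hP
    exact if_neg fun h => hne (eq_singleton_of_noncrossing_of_unsplit hn hP.1 h hP.2)
  · intro h
    exact (h (Finset.mem_filter.2 ⟨mem_partsOf.2 (isPart_singleton hn), unsplit_singleton⟩)).elim

end Weights

/-! ### Connectedness and irreducibility in terms of saturated intervals. -/

theorem saturated_iff_exists_sup {s t : Finset ℕ} {P : Finset (Finset ℕ)} (hP : IsPart s P)
    (ht : t ⊆ s) : Saturated P t ↔ ∃ T ⊆ P, T.sup id = t := by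
  classical
  constructor
  · intro h
    refine ⟨P.filter (· ⊆ t), Finset.filter_subset _ _, ?_⟩
    ext x
    simp only [Finset.mem_sup, Finset.mem_filter, id]
    constructor
    · rintro ⟨B, hB, hx⟩
      exact hB.2 hx
    · intro hx
      obtain ⟨B, hB, hxB⟩ := hP.2.2.1 x (ht hx)
      exact ⟨B, ⟨hB, fun y hy => h B hB x hxB y hy hx⟩, hxB⟩
  · rintro ⟨T, hT, rfl⟩ B hB x hx y hy hxt
    obtain ⟨C, hC, hxC⟩ := Finset.mem_sup.1 hxt
    obtain rfl := hP.2.2.2 B hB C (hT hC) x hx hxC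
    exact Finset.mem_sup.2 ⟨B, hC, hy⟩

theorem SetPartition.isConnected_iff {n : ℕ} (π : SetPartition n) :
    π.IsConnected ↔ Unsplit n n π.parts := by
  have e : ∀ a b, Finset.Icc (a + 1) b = Finset.Ioc a b := fun a b => by
    ext x
    simp only [Finset.mem_Icc, Finset.mem_Ioc]
    omega
  constructor
  · intro h a b hab hb hs _
    by_contra hne
    refine h (a + 1) b (by omega) (by omega) hb (fun h' => hne ?_) ?_
    · have h1 : a + 1 ∈ Finset.Icc 1 n := h' ▸ Finset.mem_Icc.2 (by omega)
      have h2 : 1 ∈ Finset.Icc (a + 1) b := h' ▸ Finset.mem_Icc.2 (by omega)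
      have h3 : n ∈ Finset.Icc (a + 1) b := h' ▸ Finset.mem_Icc.2 (by omega)
      rw [Finset.mem_Icc] at h1 h2 h3
      omega
    · obtain ⟨T, hT, hTs⟩ := (saturated_iff_exists_sup π.isPart_parts fun x => by
        simp only [Finset.mem_Icc, Finset.mem_Ioc]
        omega).1 hs
      exact ⟨T, hT, hTs.trans (e a b).symm⟩
  · intro h a b ha hab hb hne hT
    obtain ⟨a, rfl⟩ : ∃ c, a = c + 1 := ⟨a - 1, by omega⟩
    obtain ⟨T, hT, hTs⟩ := hT
    have hs := (saturated_iff_exists_sup π.isPart_parts (fun x => by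
        simp only [Finset.mem_Icc, Finset.mem_Ioc]
        omega)).2 ⟨T, hT, hTs.trans (e a b)⟩
    obtain ⟨rfl, h2⟩ := h a b (by omega) hb hs (by omega)
    exact hne (by rw [le_antisymm hb h2])

/-- A saturated `(0, b]` confines the whole component of `1`, as crossing blocks lie on the same
side of `b`. Conversely, if the component of `1` has maximum `j < n`, some block leaves `(0, j]`; it
would have to cross a block of the component. -/
theorem SetPartition.isIrreducible_iff {n : ℕ} (hn : 1 ≤ n) (π : SetPartition n) :
    π.IsIrreducible ↔ NoInitial n π.parts := by
  classical
  have hP := π.isPart_parts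
  constructor
  · rintro ⟨A, hA, B, hB, h1, hnB, hAB⟩ b hb0 hbn hs
    have hsub : ∀ C ∈ π.parts, ∀ x ∈ C, x ≤ b → ∀ y ∈ C, y ≤ b := by
      intro C hC x hx hxb y hy
      have hx1 := (Finset.mem_Icc.1 (hP.2.1 C hC hx)).1
      exact (Finset.mem_Ioc.1 (hs C hC x hx y hy (Finset.mem_Ioc.2 (by omega)))).2
    have key : ∀ C D, π.SameComponent C D → ((∀ x ∈ C, x ≤ b) ↔ ∀ x ∈ D, x ≤ b) := by
      intro C D h
      induction h with
      | rel C D h =>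
        obtain ⟨hC, hD, p, hp, q, hq, r, hr, t, ht, _⟩ := h
        constructor
        · intro h
          have := h r hr
          exact hsub D hD q hq (by omega)
        · intro h
          have := h q hq
          exact hsub C hC p hp (by omega)
      | refl => exact Iff.rfl
      | symm _ _ _ ih => exact ih.symm
      | trans _ _ _ _ _ ih ih' => exact ih.trans ih'
    have := (key A B hAB).1 (hsub A hA 1 h1 hb0) n hnB
    omega
  · intro h
    obtain ⟨A, hA, h1⟩ := hP.2.2.1 1 (Finset.mem_Icc.2 ⟨le_rfl, hn⟩)
    obtain ⟨B, hB, hnB⟩ := hP.2.2.1 n (Finset.mem_Icc.2 ⟨hn, le_rfl⟩)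
    refine ⟨A, hA, B, hB, h1, hnB, ?_⟩
    let K := (π.parts.filter (π.SameComponent A)).sup id
    have hK : ∀ x, x ∈ K ↔ ∃ C ∈ π.parts, π.SameComponent A C ∧ x ∈ C := by
      intro x
      simp only [K, Finset.mem_sup, Finset.mem_filter, id, and_assoc]
    have h1K : 1 ∈ K := (hK 1).2 ⟨A, hA, Relation.EqvGen.refl A, h1⟩
    obtain ⟨D, hD, hAD, hj⟩ := (hK _).1 (K.max'_mem ⟨1, h1K⟩)
    have hmax : ∀ x ∈ K, x ≤ K.max' ⟨1, h1K⟩ := fun x hx => K.le_max' x hx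
    generalize K.max' ⟨1, h1K⟩ = j at hj hmax
    have hjn := Finset.mem_Icc.1 (hP.2.1 D hD hj)
    rcases eq_or_lt_of_le hjn.2 with rfl | hlt
    · rwa [hP.2.2.2 B hB D hD j hnB hj]
    · refine (h j (by omega) hlt fun E hE x hx y hy hxj => ?_).elim
      rw [Finset.mem_Ioc] at hxj ⊢
      have hy1 := (Finset.mem_Icc.1 (hP.2.1 E hE hy)).1
      refine ⟨by omega, ?_⟩
      by_contra hyj
      have hAE : ¬ π.SameComponent A E := fun hAE =>
        hyj (hmax y ((hK y).2 ⟨E, hE, hAE, hy⟩))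
      -- The block `E` contains `x ≤ j < y`. A block of the component with `u < x < v` has `v ≤ j <
      -- y`, so it crosses `E` and puts `E` into the component.
      have side : ∀ C ∈ π.parts, π.SameComponent A C → ∀ u ∈ C, ∀ v ∈ C, u < x → v < x := by
        intro C hC hAC u hu v hv hux
        by_contra hvx
        have hCE : C ≠ E := fun e => hAE (e ▸ hAC)
        have hvx' : v ≠ x := fun e => hCE (hP.2.2.2 C hC E hE x (e ▸ hv) hx)
        have := hmax v ((hK v).2 ⟨C, hC, hAC, hv⟩)
        exact hAE (hAC.trans _ _ _ (Relation.EqvGen.rel _ _ ⟨hC, hE, u, hu, x, hx, v, hv, y, hy,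
          by omega, by omega, by omega⟩))
      -- Crossing blocks overlap in range, so all blocks of the component lie on the same side of
      -- `x`; but `1 < x ≤ j`, and both `1` and `j` are in the component.
      have key : ∀ C E, π.SameComponent C E → π.SameComponent A C →
          ((∀ u ∈ C, u < x) ↔ ∀ u ∈ E, u < x) := by
        intro C E h
        induction h with
        | rel C E h =>
          intro hAC
          have hAE : π.SameComponent A E := hAC.trans _ _ _ (Relation.EqvGen.rel _ _ h)
          obtain ⟨hC, hE, p, hp, q, hq, r, hr, t, ht, _⟩ := h
          constructor
          · intro h
            have := h r hr
            exact fun u hu => side E hE hAE q hq u hu (by omega)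
          · intro h
            have := h q hq
            exact fun u hu => side C hC hAC p hp u hu (by omega)
        | refl => exact fun _ => Iff.rfl
        | symm C E h ih => exact fun hAE => (ih (hAE.trans _ _ _ (h.symm _ _))).symm
        | trans C E F h _ ih ih' => exact fun hAC => (ih hAC).trans (ih' (hAC.trans _ _ _ h))
      have h1x : 1 < x := by
        refine lt_of_le_of_ne (by omega) fun e => hAE ?_
        rw [← hP.2.2.2 A hA E hE x (e ▸ h1) hx]
        exact Relation.EqvGen.refl A
      have := (key A D hAD (Relation.EqvGen.refl A)).1
        (fun u hu => side A hA (Relation.EqvGen.refl A) 1 h1 u hu h1x) j hj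
      omega

/-! ### The classical moment-cumulant formula. -/

section ClassicalCumulants

/-- Classify a partition by the block of `a`, which is `insert a B`; the other blocks partition `s \
B`. -/
theorem sum_partsOf_insert {R : Type*} [AddCommMonoid R] {s : Finset ℕ} {a : ℕ} (ha : a ∉ s)
    (w : Finset (Finset ℕ) → R) :
    ∑ P ∈ partsOf (insert a s), w P =
      ∑ B ∈ s.powerset, ∑ P ∈ partsOf (s \ B), w (insert (insert a B) P) := by
  classical
  rw [Finset.sum_sigma']
  symm
  have out : ∀ B P, IsPart (s \ B) P → ∀ C ∈ P, ∀ x ∈ C, x ∈ s ∧ x ∉ B ∧ x ≠ a := by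
    intro B P hP C hC x hx
    have := Finset.mem_sdiff.1 (hP.2.1 C hC hx)
    exact ⟨this.1, this.2, fun e => ha (e ▸ this.1)⟩
  refine Finset.sum_bij (fun p _ => insert (insert a p.1) p.2) ?_ ?_ ?_ (fun _ _ => rfl)
  · rintro ⟨B, P⟩ h
    simp only [Finset.mem_sigma, Finset.mem_powerset, mem_partsOf] at h ⊢
    obtain ⟨hB, hP⟩ := h
    refine ⟨fun C hC => ?_, fun C hC => ?_, fun x hx => ?_, fun C hC D hD x hx hx' => ?_⟩
    · rcases Finset.mem_insert.1 hC with rfl | hC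
      · exact Finset.insert_nonempty _ _
      · exact hP.1 C hC
    · rcases Finset.mem_insert.1 hC with rfl | hC
      · exact Finset.insert_subset_insert _ hB
      · exact fun x hx => Finset.mem_insert_of_mem (out B P hP C hC x hx).1
    · by_cases hxB : x ∈ insert a B
      · exact ⟨_, Finset.mem_insert_self _ _, hxB⟩
      · rw [Finset.mem_insert, not_or] at hxB
        obtain ⟨C, hC, hxC⟩ := hP.2.2.1 x
          (Finset.mem_sdiff.2 ⟨(Finset.mem_insert.1 hx).resolve_left hxB.1, hxB.2⟩)
        exact ⟨C, Finset.mem_insert_of_mem hC, hxC⟩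
    · have hno : ∀ E ∈ P, x ∈ E → x ∉ insert a B := fun E hE hxE hxa => by
        have := out B P hP E hE x hxE
        rcases Finset.mem_insert.1 hxa with h | h
        · exact this.2.2 h
        · exact this.2.1 h
      rcases Finset.mem_insert.1 hC with rfl | hC' <;> rcases Finset.mem_insert.1 hD with rfl | hD'
      · rfl
      · exact (hno D hD' hx' hx).elim
      · exact (hno C hC' hx hx').elim
      · exact hP.2.2.2 C hC' D hD' x hx hx'
  · rintro ⟨B, P⟩ h ⟨D, Q⟩ g e
    simp only [Finset.mem_sigma, Finset.mem_powerset, mem_partsOf] at h g e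
    have hBP : insert a B ∉ P := fun hm => (out B P h.2 _ hm a (Finset.mem_insert_self _ _)).2.2 rfl
    have hDQ : insert a D ∉ Q := fun hm => (out D Q g.2 _ hm a (Finset.mem_insert_self _ _)).2.2 rfl
    have hm : insert a B ∈ insert (insert a D) Q := e ▸ Finset.mem_insert_self _ _
    have hBD : insert a B = insert a D := (Finset.mem_insert.1 hm).resolve_right fun hm =>
      (out D Q g.2 _ hm a (Finset.mem_insert_self _ _)).2.2 rfl
    have hBD' : B = D := by
      rw [← Finset.erase_insert (fun h' => ha (h.1 h')), hBD,
        Finset.erase_insert (fun h' => ha (g.1 h'))]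
    subst hBD'
    have : P = Q := by rw [← Finset.erase_insert hBP, e, Finset.erase_insert hDQ]
    rw [this]
  · intro P hP
    rw [mem_partsOf] at hP
    obtain ⟨C, hC, haC⟩ := hP.2.2.1 a (Finset.mem_insert_self _ _)
    refine ⟨⟨C.erase a, P.erase C⟩, ?_, ?_⟩
    · simp only [Finset.mem_sigma, Finset.mem_powerset, mem_partsOf]
      refine ⟨fun x hx => ?_, fun D hD => hP.1 D (Finset.mem_of_mem_erase hD),
        fun D hD x hx => ?_, fun x hx => ?_, fun D hD E hE => hP.2.2.2 D (Finset.mem_of_mem_erase hD)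
          E (Finset.mem_of_mem_erase hE)⟩
      · have := Finset.mem_erase.1 hx
        exact (Finset.mem_insert.1 (hP.2.1 C hC this.2)).resolve_left this.1
      · have hD := Finset.mem_erase.1 hD
        have hxC : x ∉ C := fun h => hD.1 (hP.2.2.2 D hD.2 C hC x hx h)
        refine Finset.mem_sdiff.2 ⟨(Finset.mem_insert.1 (hP.2.1 D hD.2 hx)).resolve_left ?_,
          fun h => hxC (Finset.mem_of_mem_erase h)⟩
        rintro rfl
        exact hxC haC
      · have hx := Finset.mem_sdiff.1 hx
        obtain ⟨D, hD, hxD⟩ := hP.2.2.1 x (Finset.mem_insert_of_mem hx.1)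
        refine ⟨D, Finset.mem_erase.2 ⟨?_, hD⟩, hxD⟩
        rintro rfl
        exact hx.2 (Finset.mem_erase.2 ⟨fun e => ha (e ▸ hx.1), hxD⟩)
    · simp only [Finset.insert_erase haC, Finset.insert_erase hC]

variable {R : Type*} [CommRing R]

/-- The moment-cumulant formula, for moments given by the exponential recursion. -/
theorem sum_blockWeight_eq (f μ : ℕ → R) (h0 : μ 0 = 1)
    (hμ : ∀ n, μ (n + 1) = ∑ k ∈ Finset.range (n + 1), (n.choose k : R) * (f (k + 1) * μ (n - k)))
    (s : Finset ℕ) : ∑ P ∈ partsOf s, blockWeight f P = μ s.card := by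
  classical
  induction s using Finset.strongInduction with
  | H s ih =>
    rcases s.eq_empty_or_nonempty with rfl | ⟨a, ha⟩
    · simp [partsOf_empty, blockWeight, h0]
    · obtain ⟨t, hat, rfl⟩ : ∃ t, a ∉ t ∧ insert a t = s :=
        ⟨s.erase a, Finset.notMem_erase _ _, Finset.insert_erase ha⟩
      rw [sum_partsOf_insert hat, Finset.card_insert_of_notMem hat, hμ]
      have key : ∀ B ∈ t.powerset,
          ∑ P ∈ partsOf (t \ B), blockWeight f (insert (insert a B) P) =
            f (B.card + 1) * μ (t.card - B.card) := by
        intro B hB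
        rw [Finset.mem_powerset] at hB
        rw [← Finset.card_sdiff_of_subset hB, ← ih (t \ B)
          (Finset.ssubset_of_subset_of_ssubset Finset.sdiff_subset (Finset.ssubset_insert hat)),
          Finset.mul_sum]
        refine Finset.sum_congr rfl fun P hP => ?_
        have hP := mem_partsOf.1 hP
        rw [blockWeight, Finset.prod_insert, Finset.card_insert_of_notMem fun h => hat (hB h)]
        · rfl
        · exact fun h => hat (Finset.mem_sdiff.1 (hP.2.1 _ h (Finset.mem_insert_self _ _))).1
      rw [Finset.sum_congr rfl key,
        Finset.sum_powerset_apply_card (fun i => f (i + 1) * μ (t.card - i))]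
      simp only [nsmul_eq_mul]

variable [Algebra ℚ R]

/-- The chain rule, with `PowerSeries.log` being the series of `log (1 + X)`, evaluated at `F - 1`.
-/
theorem mul_derivative_logOf {F : R⟦X⟧} (hF : PowerSeries.constantCoeff F = 1) :
    F * PowerSeries.derivative R (PowerSeries.logOf F) = PowerSeries.derivative R F := by
  have hs : PowerSeries.HasSubst (F - 1) :=
    PowerSeries.HasSubst.of_constantCoeff_zero' (by simp [hF])
  have hG : (1 + PowerSeries.X) * PowerSeries.derivative R (PowerSeries.log R) = 1 := by
    rw [PowerSeries.deriv_log]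
    ext n
    rcases n with _ | n
    · simp
    · simp [add_mul, PowerSeries.coeff_succ_X_mul, pow_succ, PowerSeries.coeff_one]
  have hsub : F * (PowerSeries.derivative R (PowerSeries.log R)).subst (F - 1) = 1 := by
    have := congrArg (PowerSeries.substAlgHom (R := R) hs) hG
    rw [map_mul, map_add, map_one, PowerSeries.substAlgHom_X, PowerSeries.coe_substAlgHom] at this
    rwa [add_sub_cancel] at this
  rw [PowerSeries.logOf_eq, PowerSeries.derivative_subst hs, map_sub,
    ← mul_assoc, hsub, one_mul, PowerSeries.derivative_one, sub_zero]

theorem constantCoeff_expMomentSeries (m : ℕ → R) :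
    PowerSeries.constantCoeff (expMomentSeries m) = 1 := by
  rw [← PowerSeries.coeff_zero_eq_constantCoeff_apply]
  simp [expMomentSeries]

theorem factorial_mul_coeff_expMomentSeries (m : ℕ → R) (n : ℕ) :
    (n.factorial : R) * PowerSeries.coeff n (expMomentSeries m) = if n = 0 then 1 else m n := by
  rw [expMomentSeries, PowerSeries.coeff_mk]
  split_ifs with h
  · simp [h]
  · rw [← mul_assoc, ← map_natCast (algebraMap ℚ R), ← map_mul,
      mul_one_div_cancel (by exact_mod_cast n.factorial_ne_zero), map_one, one_mul]

/-- This is `F (log F)' = F'` read off in degree `n` and multiplied by `n!`. It has the same form as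
the recursion over the block of a distinguished element. -/
theorem classicalCumulant_rec (m : ℕ → R) (n : ℕ) :
    m (n + 1) = ∑ k ∈ Finset.range (n + 1), (n.choose k : R) *
      (classicalCumulant m (k + 1) * if n - k = 0 then 1 else m (n - k)) := by
  have h := congrArg (fun G => (n.factorial : R) * PowerSeries.coeff n G)
    (mul_derivative_logOf (constantCoeff_expMomentSeries m))
  rw [mul_comm (expMomentSeries m), PowerSeries.coeff_mul,
      Finset.Nat.sum_antidiagonal_eq_sum_range_succ (fun i j =>
        PowerSeries.coeff i (PowerSeries.derivative R (PowerSeries.logOf (expMomentSeries m))) *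
          PowerSeries.coeff j (expMomentSeries m)), PowerSeries.coeff_derivative] at h
  have hm := factorial_mul_coeff_expMomentSeries m (n + 1)
  rw [if_neg n.succ_ne_zero, Nat.factorial_succ] at hm
  push_cast at hm
  rw [← hm]
  calc _ = (n.factorial : R) * (PowerSeries.coeff (n + 1) (expMomentSeries m) * (n + 1)) := by ring
    _ = _ := h.symm
    _ = _ := by
      rw [Finset.mul_sum]
      refine Finset.sum_congr rfl fun k hk => ?_
      have hk := Nat.lt_succ_iff.1 (Finset.mem_range.1 hk)
      rw [← factorial_mul_coeff_expMomentSeries, classicalCumulant,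
        ← Nat.choose_mul_factorial_mul_factorial hk, Nat.factorial_succ,
        PowerSeries.coeff_derivative]
      push_cast
      ring

end ClassicalCumulants

/-! ### Uniqueness of `M` and identification of the cumulants. -/

theorem PowerSeries.coeff_pow_congr {R : Type*} [CommRing R] {A B : R⟦X⟧} {n : ℕ}
    (h : ∀ i ≤ n, PowerSeries.coeff i A = PowerSeries.coeff i B) (d : ℕ) :
    ∀ i ≤ n, PowerSeries.coeff i (A ^ d) = PowerSeries.coeff i (B ^ d) := by
  induction d with
  | zero => simp
  | succ d ih =>
    intro i hi
    rw [pow_succ, pow_succ, PowerSeries.coeff_mul, PowerSeries.coeff_mul]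
    refine Finset.sum_congr rfl fun p hp => ?_
    have := Finset.HasAntidiagonal.mem_antidiagonal.1 hp
    rw [ih p.1 (by omega), h p.2 (by omega)]

/-- The equation `M(z) = C(z M(z))` determines `M`. -/
theorem eq_of_subst_X_mul_eq {R : Type*} [CommRing R] {C M M' : R⟦X⟧}
    (h : C.subst (PowerSeries.X * M) = M) (h' : C.subst (PowerSeries.X * M') = M') : M = M' := by
  ext n
  induction n using Nat.strong_induction_on with
  | _ n ih =>
    rw [← h, ← h', coeff_subst_X_mul, coeff_subst_X_mul]
    refine Finset.sum_congr rfl fun d _ => ?_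
    -- The term `d = 0` does not involve `M`; for `d ≥ 1` the factor `X ^ d` leaves only
    -- coefficients of `M` of degree below `n`.
    rcases d with _ | d
    · simp
    · rw [mul_pow, mul_pow, PowerSeries.coeff_X_pow_mul', PowerSeries.coeff_X_pow_mul']
      split_ifs with hd
      · rw [PowerSeries.coeff_pow_congr (fun i hi => ih i (by omega)) (d + 1) _ le_rfl]
      · rfl

section Cumulants

variable {R : Type*} [CommRing R]

theorem constantCoeff_connectedSeries {w : Finset (Finset ℕ) → R} (hw : IsGapMultiplicative w) :
    PowerSeries.constantCoeff (connectedSeries w) = 1 := by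
  rw [← PowerSeries.coeff_zero_eq_constantCoeff_apply, connectedSeries, PowerSeries.coeff_mk,
    hw.unsplitWeight_zero]

/-- Both series solve the same equation `M = C(z M)`, because only the one-block partition is both
noncrossing and connected. -/
theorem totalSeries_noncrossingWeight (m : ℕ → R) :
    totalSeries (noncrossingWeight (freeCumulant m)) = momentSeries m := by
  have hw := isGapMultiplicative_noncrossingWeight (freeCumulant m)
  have hC : connectedSeries (noncrossingWeight (freeCumulant m)) = freeSeries m := by
    ext n
    rcases Nat.eq_zero_or_pos n with rfl | hn
    · rw [PowerSeries.coeff_zero_eq_constantCoeff_apply,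
        PowerSeries.coeff_zero_eq_constantCoeff_apply, constantCoeff_connectedSeries hw,
        (freeSeries_spec m).1]
    · rw [connectedSeries, PowerSeries.coeff_mk, unsplitWeight_noncrossingWeight _ hn,
        freeCumulant]
  refine eq_of_subst_X_mul_eq (C := freeSeries m) ?_ (freeSeries_spec m).2
  rw [← hC]
  exact hw.subst_connectedSeries

theorem totalSeries_classicalCumulant [Algebra ℚ R] (m : ℕ → R) :
    totalSeries (blockWeight (classicalCumulant m)) = momentSeries m := by
  ext n
  rw [totalSeries, momentSeries, PowerSeries.coeff_mk, PowerSeries.coeff_mk, totalWeight,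
    sum_blockWeight_eq (classicalCumulant m) (fun n => if n = 0 then 1 else m n) rfl
      (fun n => classicalCumulant_rec m n), Nat.card_Icc, Nat.add_sub_cancel]

theorem freeCumulant_eq_unsplitWeight {m : ℕ → R} {w : Finset (Finset ℕ) → R}
    (hw : IsGapMultiplicative w) (hm : totalSeries w = momentSeries m) (n : ℕ) :
    freeCumulant m n = unsplitWeight w n n := by
  have : freeSeries m = connectedSeries w :=
    (existsUnique_freeSeries m).unique (freeSeries_spec m)
      ⟨constantCoeff_connectedSeries hw, hm ▸ hw.subst_connectedSeries⟩
  rw [freeCumulant, this, connectedSeries, PowerSeries.coeff_mk]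

theorem booleanCumulant_eq_noInitialWeight {m : ℕ → R} {w : Finset (Finset ℕ) → R}
    (hw : IsGapMultiplicative w) (hm : totalSeries w = momentSeries m) {n : ℕ} (hn : 1 ≤ n) :
    booleanCumulant m n = noInitialWeight w n :=
  hw.totalSeries_mul _ (hm ▸ momentSeries_mul_one_sub_booleanSeries m) hn

end Cumulants

theorem mainTheorem1 {R : Type*} [CommRing R] [Algebra ℚ R] (m : ℕ → R) (n : ℕ) (hn : 1 ≤ n) :
    freeCumulant m n =
        ∑ π ∈ connectedPartitions n, SetPartition.multiplicative (classicalCumulant m) π ∧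
    booleanCumulant m n =
        ∑ π ∈ irreduciblePartitions n, SetPartition.multiplicative (classicalCumulant m) π ∧
    booleanCumulant m n =
        ∑ π ∈ irreducibleNoncrossingPartitions n,
          SetPartition.multiplicative (freeCumulant m) π := by
  classical
  have hκ := isGapMultiplicative_blockWeight (classicalCumulant m)
  have hm := totalSeries_classicalCumulant m
  refine ⟨?_, ?_, ?_⟩
  · rw [freeCumulant_eq_unsplitWeight hκ hm]
    exact (sum_finpartition_filter _ _ _ fun π => SetPartition.isConnected_iff π).symm
  · rw [booleanCumulant_eq_noInitialWeight hκ hm hn]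
    exact (sum_finpartition_filter _ _ _ fun π => SetPartition.isIrreducible_iff hn π).symm
  · rw [booleanCumulant_eq_noInitialWeight (isGapMultiplicative_noncrossingWeight _)
      (totalSeries_noncrossingWeight m) hn, noInitialWeight]
    -- The weight vanishes on crossing partitions, so the sum becomes one over irreducible
    -- noncrossing partitions.
    simp only [noncrossingWeight]
    rw [← Finset.sum_filter, Finset.filter_filter]
    exact (sum_finpartition_filter _ _ _ fun π =>
      (and_congr Iff.rfl (SetPartition.isIrreducible_iff hn π)).trans and_comm).symm
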